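/- Let $G$ be a compact Hausdorff topological group with normalized Haar measure $\mu$, and let $\widehat G$ be its dual object: the set of equivalence classes of irreducible continuous unitary representations, each represented by a fixed $\pi:G\to U(\mathbb C^{d_\pi})$. Let $E\neq\{0\}$ be an operator space, i.e. a closed subspace of $B(H)$ for some Hilbert space $H$, with $M_n(E)\subset B(\ell^2_H(n))$. For a linear map $u:V\to W$ between operator spaces put $\|u\|_{cb}=\sup_{n\ge1}\|I_{M_n}\otimes u:M_n(V)\to M_n(W)\|$. Let $S^1_d=(M_d)^\star$ be the operator space dual of $M_d$ under the trace pairing, and let $S^1_d(E)=S^1_d\otimes^\wedge E$ (operator space projective tensor product), as a norm on $M_d\otimes E$. Let $\mathcal L^1_E(\widehat G)$ be the space of all $A=(A^\pi)_\pi\in\prod_{\pi\in\widehat G}M_{d_\pi}\otimes E$ with $\sum_{\pi}d_\pi\|A^\pi\|_{S^1_{d_\pi}(E)}<\infty$, with the operator space structure of the $\ell_1$-direct sum of the spaces $S^1_{d_\pi}(E)$ with weights $d_\pi$; write $\mathcal L^1(\widehat G)$ for $E=\mathbb C$. Let $L^\infty_E(G)$ be the Bochner–Lebesgue space with the operator space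 structure $M_n(L^\infty_E(G))=L^\infty_{M_n(E)}(G)$. The inverse Fourier transform on $\mathcal L^1(\widehat G)$ is $\mathcal F_G^{-1}(B)(g)=\sum_\pi d_\pi\operatorname{tr}(B^\pi\pi(g))$. Then $E$ has Fourier cotype $\infty$ with respect to $G$, with constant $\mathcal C^2_\infty(E,G)=1$. That is, $\mathcal F_G^{-1}\otimes \mathrm{id}_E:\mathcal L^1(\widehat G)\otimes E\to L^\infty(G)\otimes E$ extends to a completely bounded linear operator $\Lambda:\mathcal L^1_E(\widehat G)\to L^\infty_E(G)$; this completely bounded extension is unique, and $\|\Lambda\|_{cb}=1$. Moreover, for every $A\in\mathcal L^1_E(\widehat G)$ the series $\sum_{\pi}d_\pi\operatorname{tr}(A^\pi\pi(g))$ converges unconditionally in $E$ for every $g\in G$, and its sum is $\Lambda(A)(g)$ for almost every $g\in G$. -/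

import Mathlib

open MeasureTheory
open scoped ENNReal TensorProduct

noncomputable section

namespace FourierCotype

/-! ### Operator spaces, matrix norms, completely bounded maps -/

/-- A family of (extended nonnegative) matrix norms: one on each space `M_n(V) = M_n ⊗ V`. -/
abbrev MatNorm (V : Type*) : Type _ := (n : ℕ) → Matrix (Fin n) (Fin n) V → ℝ≥0∞

/-- The completely bounded norm `sup_n ‖I_{M_n} ⊗ u : M_n(V) → M_n(W)‖` of a linear map,
with value `∞` if `u` is not completely bounded. -/
def cbNorm {V W : Type*} [AddCommGroup V] [Module ℂ V] [AddCommGroup W] [Module ℂ W]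
    (NV : MatNorm V) (NW : MatNorm W) (u : V →ₗ[ℂ] W) : ℝ≥0∞ :=
  ⨆ (n : ℕ) (X : Matrix (Fin n) (Fin n) V) (_ : NV n X ≤ 1), NW n (X.map u)

/-- A matrix of bounded operators on `H`, acting on `ℓ²(ι; H)`. -/
def blockOp {ι H : Type*} [Fintype ι] [NormedAddCommGroup H] [InnerProductSpace ℂ H]
    (X : Matrix ι ι (H →L[ℂ] H)) :
    PiLp 2 (fun _ : ι => H) →L[ℂ] PiLp 2 (fun _ : ι => H) :=
  (PiLp.continuousLinearEquiv 2 ℂ (fun _ : ι => H)).symm.toContinuousLinearMap ∘L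
    (ContinuousLinearMap.pi fun i => ∑ j, X i j ∘L ContinuousLinearMap.proj j) ∘L
    (PiLp.continuousLinearEquiv 2 ℂ (fun _ : ι => H)).toContinuousLinearMap

/-- An operator space is a Banach space `E` together with a linear isometry `J` of `E` onto a
(closed) subspace of `B(H)`, `H` a Hilbert space. Its matrix norms: `M_n(E)` is normed as a
subspace of `B(ℓ²_H(n))`. -/
def opNorm {H : Type*} [NormedAddCommGroup H] [InnerProductSpace ℂ H]
    {E : Type*} [NormedAddCommGroup E] [NormedSpace ℂ E] (J : E →ₗᵢ[ℂ] (H →L[ℂ] H)) : MatNorm E :=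
  fun _ X => ‖blockOp (X.map J)‖ₑ

/-- The norm of `M_ι(M_d)`: the operator norm on `ℓ²(ι × d)` of a matrix with entries in `M_d`. -/
def blockNorm {ι : Type*} [Fintype ι] [DecidableEq ι] {d : ℕ}
    (X : Matrix ι ι (Matrix (Fin d) (Fin d) ℂ)) : ℝ≥0∞ :=
  ‖Matrix.toEuclideanCLM (𝕜 := ℂ) (Matrix.comp ι ι (Fin d) (Fin d) ℂ X)‖ₑ

/-- The operator space `S^∞_d = M_d = B(ℓ²(d))`. -/
def sInfNorm (d : ℕ) : MatNorm (Matrix (Fin d) (Fin d) ℂ) := fun _ X => blockNorm X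

/-- For `x ∈ M_p(M_d)`, the map `M_d → M_p`, `B ↦ (tr (x_ij B))_ij`. -/
def tracePairing {p d : ℕ} (x : Matrix (Fin p) (Fin p) (Matrix (Fin d) (Fin d) ℂ)) :
    Matrix (Fin d) (Fin d) ℂ →ₗ[ℂ] Matrix (Fin p) (Fin p) ℂ where
  toFun B := Matrix.of fun i j => Matrix.trace (x i j * B)
  map_add' B C := by ext i j; simp [Matrix.mul_add]
  map_smul' c B := by ext i j; simp

/-- The operator space `S^1_d = (S^∞_d)^*` under the trace pairing: by definition of the operator
space dual, `M_p((S^∞_d)^*)` carries the norm of `cb(S^∞_d, M_p)`. -/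
def sOneNorm (d : ℕ) : MatNorm (Matrix (Fin d) (Fin d) ℂ) :=
  fun p x => cbNorm (sInfNorm d) (sInfNorm p) (tracePairing x)

/-- `φ : V ⊗ W → M_m` is jointly completely contractive as a bilinear map, i.e. it corresponds to
an element of the unit ball of `M_m(cb(V, W^*)) = cb(V, cb(W, M_m))`. -/
def JointlyCC {V W : Type*} [AddCommGroup V] [Module ℂ V] [AddCommGroup W] [Module ℂ W]
    (NV : MatNorm V) (NW : MatNorm W) {m : ℕ}
    (φ : V ⊗[ℂ] W →ₗ[ℂ] Matrix (Fin m) (Fin m) ℂ) : Prop :=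
  ∀ (p q : ℕ) (x : Matrix (Fin p) (Fin p) V) (y : Matrix (Fin q) (Fin q) W),
    blockNorm (Matrix.of fun (a b : Fin p × Fin q) => φ (x a.1 b.1 ⊗ₜ[ℂ] y a.2 b.2))
      ≤ NV p x * NW q y

/-- The operator space projective tensor norms (on the algebraic tensor product), in their
Blecher-Paulsen form: the matrix norms for which
`(V ⊗^ W)^* = cb(V, W^*)` completely isometrically, i.e. the norm of `U ∈ M_n(V ⊗ W)` is the
supremum of `‖(φ(U_ij))‖_{M_n(M_m)}` over all jointly completely contractive `φ : V × W → M_m`. -/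
def projNorm {V W : Type*} [AddCommGroup V] [Module ℂ V] [AddCommGroup W] [Module ℂ W]
    (NV : MatNorm V) (NW : MatNorm W) : MatNorm (V ⊗[ℂ] W) :=
  fun _ U => ⨆ (m : ℕ) (φ : V ⊗[ℂ] W →ₗ[ℂ] Matrix (Fin m) (Fin m) ℂ) (_ : JointlyCC NV NW φ),
    blockNorm (U.map φ)

/-- The identification `M_d(E) = M_d ⊗ E`. -/
def toTensor (d : ℕ) (E : Type*) [AddCommGroup E] [Module ℂ E] :
    Matrix (Fin d) (Fin d) E →ₗ[ℂ] Matrix (Fin d) (Fin d) ℂ ⊗[ℂ] E where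
  toFun A := ∑ i, ∑ j, Matrix.single i j (1 : ℂ) ⊗ₜ[ℂ] A i j
  map_add' A B := by simp [TensorProduct.tmul_add, Finset.sum_add_distrib]
  map_smul' c A := by simp [Finset.smul_sum]

/-- The operator space `S^1_d(E) = S^1_d ⊗^ E`. -/
def sOneNormE {H : Type*} [NormedAddCommGroup H] [InnerProductSpace ℂ H]
   
    {E : Type*} [NormedAddCommGroup E] [NormedSpace ℂ E] (J : E →ₗᵢ[ℂ] (H →L[ℂ] H)) (d : ℕ) : MatNorm (Matrix (Fin d) (Fin d) E) :=
  fun n X => projNorm (sOneNorm d) (opNorm J) n (X.map (toTensor d E))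

/-- The norm of a vector: the first of the matrix norms. -/
def MatNorm.vec {V : Type*} (N : MatNorm V) (v : V) : ℝ≥0∞ := N 1 (Matrix.of fun _ _ => v)

/-! ### The dual object of a compact group -/

/-- An irreducible continuous unitary representation of `G` on some `ℂ^d`, in matrix form. -/
structure IrredUnitaryRep (G : Type*) [Group G] [TopologicalSpace G] where
  /-- the degree -/
  dim : ℕ
  dim_pos : 0 < dim
  /-- the representation -/
  hom : G →* Matrix.unitaryGroup (Fin dim) ℂ
  continuous_hom : Continuous hom
  irreducible : ∀ W : Submodule ℂ (Fin dim → ℂ),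
    (∀ g, ∀ v ∈ W, (hom g : Matrix (Fin dim) (Fin dim) ℂ).mulVec v ∈ W) → W = ⊥ ∨ W = ⊤

/-- The matrix `π(g)`. -/
def IrredUnitaryRep.mat {G : Type*} [Group G] [TopologicalSpace G] (π : IrredUnitaryRep G)
    (g : G) : Matrix (Fin π.dim) (Fin π.dim) ℂ := (π.hom g : Matrix (Fin π.dim) (Fin π.dim) ℂ)

/-- Unitary equivalence of representations. -/
def IrredUnitaryRep.setoid (G : Type*) [Group G] [TopologicalSpace G] :
    Setoid (IrredUnitaryRep G) where
  r π ρ := ∃ U : Matrix (Fin ρ.dim) (Fin π.dim) ℂ,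
    U.conjTranspose * U = 1 ∧ U * U.conjTranspose = 1 ∧ ∀ g, U * π.mat g = ρ.mat g * U
  iseqv :=
    { refl := fun π => ⟨1, by simp, by simp, by simp⟩
      symm := by
        rintro π ρ ⟨U, h1, h2, h3⟩
        refine ⟨U.conjTranspose, by simpa using h2, by simpa using h1, fun g => ?_⟩
        calc U.conjTranspose * ρ.mat g
            = U.conjTranspose * (ρ.mat g * U) * U.conjTranspose := by
              rw [Matrix.mul_assoc, Matrix.mul_assoc, h2, Matrix.mul_one]
          _ = π.mat g * U.conjTranspose := by
              rw [← h3, ← Matrix.mul_assoc, h1, Matrix.one_mul]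
      trans := by
        rintro π ρ σ ⟨U, h1, h2, h3⟩ ⟨V, k1, k2, k3⟩
        refine ⟨V * U, ?_, ?_, fun g => ?_⟩
        · rw [Matrix.conjTranspose_mul, Matrix.mul_assoc, ← Matrix.mul_assoc V.conjTranspose, k1,
            Matrix.one_mul, h1]
        · rw [Matrix.conjTranspose_mul, Matrix.mul_assoc, ← Matrix.mul_assoc U, h2,
            Matrix.one_mul, k2]
        · rw [Matrix.mul_assoc, h3, ← Matrix.mul_assoc, k3, Matrix.mul_assoc] }

/-- The dual object `Ĝ`: equivalence classes of irreducible unitary representations. -/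
def DualObject (G : Type*) [Group G] [TopologicalSpace G] : Type _ :=
  Quotient (IrredUnitaryRep.setoid G)

/-- A chosen representative of a class in `Ĝ`. -/
def DualObject.rep {G : Type*} [Group G] [TopologicalSpace G] (π : DualObject G) :
    IrredUnitaryRep G := Quotient.out π

/-- The degree `d_π`. -/
def DualObject.deg {G : Type*} [Group G] [TopologicalSpace G] (π : DualObject G) : ℕ := π.rep.dim

/-- The unitary matrix `π(g)`. -/
def DualObject.mat {G : Type*} [Group G] [TopologicalSpace G] (π : DualObject G) (g : G) :
    Matrix (Fin π.deg) (Fin π.deg) ℂ := π.rep.mat g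

/-- The product `∏_{π ∈ Ĝ} M_{d_π} ⊗ V`. -/
abbrev MSpace (G V : Type*) [Group G] [TopologicalSpace G] : Type _ :=
  ∀ π : DualObject G, Matrix (Fin π.deg) (Fin π.deg) V

/-! ### The spaces `L^1(Ĝ)` and `L^1_E(Ĝ)` -/

/-- `B ∈ L^1(Ĝ)`, i.e. `∑_π d_π ‖B^π‖_{S^1} < ∞`. -/
def MemL1Hat {G : Type*} [Group G] [TopologicalSpace G] (B : MSpace G ℂ) : Prop :=
  ∑' π : DualObject G, (π.deg : ℝ≥0∞) * (sOneNorm π.deg).vec (B π) < ∞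

section vec

variable {H : Type*} [NormedAddCommGroup H] [InnerProductSpace ℂ H]
 
    {E : Type*} [NormedAddCommGroup E] [NormedSpace ℂ E] (J : E →ₗᵢ[ℂ] (H →L[ℂ] H)) (d : ℕ)

theorem sOneNormE_vec_add_le (A B : Matrix (Fin d) (Fin d) E) :
    (sOneNormE J d).vec (A + B) ≤ (sOneNormE J d).vec A + (sOneNormE J d).vec B := by
  refine iSup_le fun m => iSup_le fun φ => iSup_le fun hφ => ?_
  refine le_trans ?_ (add_le_add
    (le_iSup_of_le m (le_iSup_of_le φ (le_iSup_of_le hφ le_rfl)))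
    (le_iSup_of_le m (le_iSup_of_le φ (le_iSup_of_le hφ le_rfl))))
  unfold blockNorm
  have h : Matrix.comp (Fin 1) (Fin 1) (Fin m) (Fin m) ℂ
        (((Matrix.of fun _ _ : Fin 1 => A + B).map (toTensor d E)).map φ) =
      Matrix.comp (Fin 1) (Fin 1) (Fin m) (Fin m) ℂ
          (((Matrix.of fun _ _ : Fin 1 => A).map (toTensor d E)).map φ) +
        Matrix.comp (Fin 1) (Fin 1) (Fin m) (Fin m) ℂ
          (((Matrix.of fun _ _ : Fin 1 => B).map (toTensor d E)).map φ) := by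
    ext i j
    simp [Matrix.comp_apply]
  rw [h, map_add, ← ofReal_norm, ← ofReal_norm, ← ofReal_norm,
    ← ENNReal.ofReal_add (norm_nonneg _) (norm_nonneg _)]
  exact ENNReal.ofReal_le_ofReal (norm_add_le _ _)

theorem sOneNormE_vec_smul_le (c : ℂ) (A : Matrix (Fin d) (Fin d) E) :
    (sOneNormE J d).vec (c • A) ≤ ‖c‖ₑ * (sOneNormE J d).vec A := by
  refine iSup_le fun m => iSup_le fun φ => iSup_le fun hφ => ?_
  refine le_trans ?_ (mul_le_mul_right
    (le_iSup_of_le m (le_iSup_of_le φ (le_iSup_of_le hφ le_rfl))) _)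
  unfold blockNorm
  have h : Matrix.comp (Fin 1) (Fin 1) (Fin m) (Fin m) ℂ
        (((Matrix.of fun _ _ : Fin 1 => c • A).map (toTensor d E)).map φ) =
      c • Matrix.comp (Fin 1) (Fin 1) (Fin m) (Fin m) ℂ
          (((Matrix.of fun _ _ : Fin 1 => A).map (toTensor d E)).map φ) := by
    ext i j
    simp [Matrix.comp_apply]
  rw [h, map_smul, enorm_smul]

end vec

/-- The space `L^1_E(Ĝ)` of all `A ∈ ∏_π M_{d_π} ⊗ E` with `∑_π d_π ‖A^π‖_{S^1(E)} < ∞`. -/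
def L1Hat (G : Type*) [Group G] [TopologicalSpace G] {H : Type*} [NormedAddCommGroup H]
    [InnerProductSpace ℂ H]
    {E : Type*} [NormedAddCommGroup E] [NormedSpace ℂ E] (J : E →ₗᵢ[ℂ] (H →L[ℂ] H)) : Submodule ℂ (MSpace G E) where
  carrier := {A | ∑' π : DualObject G, (π.deg : ℝ≥0∞) * (sOneNormE J π.deg).vec (A π) < ∞}
  add_mem' {A B} hA hB := by
    refine lt_of_le_of_lt ?_ (ENNReal.add_lt_top.2 ⟨hA, hB⟩)
    rw [← ENNReal.tsum_add]
    refine ENNReal.tsum_le_tsum fun π => ?_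
    rw [← mul_add]
    exact mul_le_mul_right (sOneNormE_vec_add_le J _ _ _) _
  zero_mem' := by
    have h : ∀ d, (sOneNormE J d).vec 0 = 0 := fun d => by
      simpa using sOneNormE_vec_smul_le J d 0 0
    simp [h]
  smul_mem' c A hA := by
    refine lt_of_le_of_lt ?_ (ENNReal.mul_lt_top (enorm_lt_top (x := c)) hA)
    rw [← ENNReal.tsum_mul_left]
    refine ENNReal.tsum_le_tsum fun π => ?_
    rw [mul_left_comm]
    exact mul_le_mul_right (sOneNormE_vec_smul_le J _ _ _) _

/-- The natural operator space structure of `L^1_E(Ĝ)`: that of the `ℓ_1`-direct sum of the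
operator spaces `S^1_{d_π}(E)` with weights `d_π`. Its norms are those for which the dual is
the `ℓ_∞`-direct sum of the duals under the pairing `∑_π d_π ⟨·, ·⟩`: the norm of `(A_ij)` is the
supremum of `‖(∑_π d_π u_π(A_ij^π))‖_{M_n(M_m)}` over all `m` and all families of complete
contractions `u_π : S^1_{d_π}(E) → M_m`. -/
def l1HatNorm (G : Type*) [Group G] [TopologicalSpace G] {H : Type*} [NormedAddCommGroup H]
    [InnerProductSpace ℂ H]
    {E : Type*} [NormedAddCommGroup E] [NormedSpace ℂ E] (J : E →ₗᵢ[ℂ] (H →L[ℂ] H)) : MatNorm (L1Hat G J) :=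
  fun n X =>
    ⨆ (m : ℕ) (u : ∀ π : DualObject G,
        Matrix (Fin π.deg) (Fin π.deg) E →ₗ[ℂ] Matrix (Fin m) (Fin m) ℂ)
      (_ : ∀ π, cbNorm (sOneNormE J π.deg) (sInfNorm m) (u π) ≤ 1),
      blockNorm (Matrix.of fun i j : Fin n =>
        ∑' π : DualObject G, (π.deg : ℂ) • u π ((X i j : MSpace G E) π))

/-! ### The space `L^∞_E(G)` and the inverse Fourier transform -/

/-- The natural operator space structure of the Bochner-Lebesgue space `L^∞_E(G)`:
`M_n(L^∞_E(G)) = L^∞_{M_n(E)}(G)`. -/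
def lInfNorm {G : Type*} [MeasurableSpace G] (μ : Measure G) {H : Type*} [NormedAddCommGroup H]
    [InnerProductSpace ℂ H]
    {E : Type*} [NormedAddCommGroup E] [NormedSpace ℂ E] (J : E →ₗᵢ[ℂ] (H →L[ℂ] H)) : MatNorm (Lp E ∞ μ) :=
  fun n F => essSup (fun g => opNorm J n (Matrix.of fun i j => F i j g)) μ

/-- The term `d_π tr(A^π π(g))` of the inverse Fourier transform; here `V = ℂ` or `V = E`. -/
def invTerm {G V : Type*} [Group G] [TopologicalSpace G] [AddCommGroup V] [Module ℂ V]
    (A : MSpace G V) (g : G) (π : DualObject G) : V :=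
  (π.deg : ℂ) • ∑ i, ∑ j, π.mat g j i • A π i j

/-- The elementary tensor `B ⊗ e`. -/
def elemTensor {G V : Type*} [Group G] [TopologicalSpace G] [AddCommGroup V] [Module ℂ V]
    (B : MSpace G ℂ) (e : V) : MSpace G V := fun π => (B π).map fun b => b • e

/-- `Λ` is a completely bounded operator `L^1_E(Ĝ) → L^∞_E(G)` extending the inverse Fourier
transform `L^1(Ĝ) ⊗ E → L^∞(G) ⊗ E`, which sends `B ⊗ e` to
`(∑_π d_π tr(B^π π(·))) ⊗ e`. -/
def IsCbExtension {G : Type*} [Group G] [TopologicalSpace G] [MeasurableSpace G] (μ : Measure G)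
    {H : Type*} [NormedAddCommGroup H] [InnerProductSpace ℂ H]
    {E : Type*} [NormedAddCommGroup E] [NormedSpace ℂ E] (J : E →ₗᵢ[ℂ] (H →L[ℂ] H))
    (Λ : L1Hat G J →ₗ[ℂ] Lp E ∞ μ) : Prop :=
  (∀ (B : MSpace G ℂ) (e : E) (A : L1Hat G J), MemL1Hat B → (A : MSpace G E) = elemTensor B e →
      ⇑(Λ A) =ᵐ[μ] fun g => (∑' π, invTerm B g π) • e) ∧
    cbNorm (l1HatNorm G J) (lInfNorm μ J) Λ < ∞

/-- `E` has Fourier cotype `∞` with respect to `G`. -/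
def HasFourierCotypeInfty {G : Type*} [Group G] [TopologicalSpace G] [MeasurableSpace G]
    (μ : Measure G) {H : Type*} [NormedAddCommGroup H] [InnerProductSpace ℂ H]
   
    {E : Type*} [NormedAddCommGroup E] [NormedSpace ℂ E] (J : E →ₗᵢ[ℂ] (H →L[ℂ] H)) : Prop :=
  ∃ Λ : L1Hat G J →ₗ[ℂ] Lp E ∞ μ, IsCbExtension μ J Λ

end FourierCotype

end

noncomputable section

namespace FourierCotype

open Filter Topology
open scoped InnerProductSpace Kronecker

/-! Evaluation at a point is already completely contractive. Fix `g`. Since `π(g)` is unitary, `tr(·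
π(g))` is a functional of norm at most one on `S^1_d`; tensored with the identity of `E`, it gives a
complete contraction `S^1_d(E) → E`. The weighted `ℓ_1`-sum norm is built so that a family of
complete contractions on the summands adds up to a complete contraction. Thus `A ↦ ∑_π d_π tr(A^π
π(g))` is completely contractive for every `g`, and the essential supremum over `g` gives `‖Λ‖_cb ≤
1`.

The norms on the left test against maps into `M_m`, while `E` sits in `B(H)`. The bridge is
compression: the norm of a matrix over `B(H)` is attained in the supremum over compressions to
finite orthonormal families (`blockNorm_compress_le`, `enorm_blockOp_le`). Compressing `tr(· u) ⊗
id_E` yields an admissible bilinear form, by multiplicativity of the norm on Kronecker products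
(`jointlyCC_traceCompress`). The pointwise estimate is `opNorm_tsum_invTerm_le`.

Convergence and continuity in `g` follow by dominating the terms by `d_π ‖A^π‖`, uniformly in `g`.
For uniqueness, finitely supported elements are sums of elementary tensors, where the extension is
prescribed, and they are dense for a norm that controls every completely bounded map
(`IsCbExtension.tendsto_truncate`). The constant 1 is reached at the trivial representation, whose
inverse transform is a constant function. -/

theorem DualObject.continuous_mat_apply {G : Type*} [Group G] [TopologicalSpace G]
    (π : DualObject G) (i j : Fin π.deg) :
    Continuous fun g => π.mat g i j := by
  have h := continuous_subtype_val.comp π.rep.continuous_hom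
  exact h.matrix_elem i j

open scoped Matrix.Norms.L2Operator

/-! ### Matrix norms -/

theorem blockNorm_eq_enorm_comp {ι : Type*} [Fintype ι] [DecidableEq ι] {d : ℕ}
    (X : Matrix ι ι (Matrix (Fin d) (Fin d) ℂ)) :
    blockNorm X = ‖Matrix.comp ι ι (Fin d) (Fin d) ℂ X‖ₑ := by
  rw [blockNorm, ← ofReal_norm, ← ofReal_norm]
  rfl

/-- A column selection matrix `S` with distinct columns satisfies `Sᴴ S = 1`, so the C*-identity
gives `‖S‖² = ‖1‖ ≤ 1`. -/
theorem l2_opNorm_one_submatrix_le {a b : Type*} [Fintype a] [Fintype b] [DecidableEq a]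
    [DecidableEq b] {h : a → b} (hh : Function.Injective h) :
    ‖(1 : Matrix b b ℂ).submatrix id h‖ ≤ 1 := by
  have h1 := Matrix.l2_opNorm_conjTranspose_mul_self ((1 : Matrix b b ℂ).submatrix id h)
  have h2 : ((1 : Matrix b b ℂ).submatrix id h).conjTranspose *
      (1 : Matrix b b ℂ).submatrix id h = 1 := by
    rw [Matrix.conjTranspose_submatrix, Matrix.conjTranspose_one,
      ← Matrix.submatrix_mul _ _ h id h Function.bijective_id, Matrix.one_mul,
      Matrix.submatrix_one _ hh]
  rw [h2] at h1
  have h3 : ‖(1 : Matrix a a ℂ)‖ ≤ 1 := by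
    rcases isEmpty_or_nonempty a with _ | _
    · rw [Subsingleton.elim (1 : Matrix a a ℂ) 0, norm_zero]; exact zero_le_one
    · exact CStarRing.norm_one.le
  nlinarith [norm_nonneg ((1 : Matrix b b ℂ).submatrix id h)]

theorem l2_opNorm_submatrix_le {m n m' n' : Type*} [Fintype m] [Fintype n] [Fintype m'] [Fintype n']
    [DecidableEq m] [DecidableEq n] [DecidableEq m'] [DecidableEq n']
    (A : Matrix m n ℂ) {f : m' → m} {g : n' → n} (hf : Function.Injective f)
    (hg : Function.Injective g) : ‖A.submatrix f g‖ ≤ ‖A‖ := by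
  have h1 : A.submatrix f g = ((1 : Matrix m m ℂ).submatrix id f).conjTranspose * A *
      (1 : Matrix n n ℂ).submatrix id g := by
    ext i j
    simp [Matrix.mul_apply, Matrix.one_apply]
  rw [h1]
  refine (Matrix.l2_opNorm_mul _ _).trans ?_
  have h2 := Matrix.l2_opNorm_mul ((1 : Matrix m m ℂ).submatrix id f).conjTranspose A
  rw [Matrix.l2_opNorm_conjTranspose] at h2
  have h3 : ‖((1 : Matrix m m ℂ).submatrix id f)‖ * ‖A‖ ≤ ‖A‖ :=
    mul_le_of_le_one_left (norm_nonneg _) (l2_opNorm_one_submatrix_le hf)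
  calc _ ≤ ‖A‖ * 1 := mul_le_mul (h2.trans h3) (l2_opNorm_one_submatrix_le hg) (norm_nonneg _) (norm_nonneg _)
    _ = ‖A‖ := mul_one _

/-- Factor `A ⊗ B = (A ⊗ 1)(1 ⊗ B)`; both embeddings are star homomorphisms of C*-algebras, hence
contractive. -/
theorem l2_opNorm_kronecker_le {m n : Type*} [Fintype m] [Fintype n] [DecidableEq m]
    [DecidableEq n] (A : Matrix m m ℂ) (B : Matrix n n ℂ) : ‖A ⊗ₖ B‖ ≤ ‖A‖ * ‖B‖ := by
  let f : Matrix m m ℂ →⋆ₙₐ[ℂ] Matrix (m × n) (m × n) ℂ :=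
    { toFun := fun A => A ⊗ₖ (1 : Matrix n n ℂ)
      map_smul' := fun c A => Matrix.smul_kronecker c A 1
      map_zero' := Matrix.zero_kronecker _
      map_add' := fun A B => Matrix.add_kronecker A B 1
      map_mul' := fun A B => by rw [← Matrix.mul_kronecker_mul, Matrix.one_mul]
      map_star' := fun A => by
        simp only [Matrix.star_eq_conjTranspose]
        rw [Matrix.conjTranspose_kronecker, Matrix.conjTranspose_one] }
  let g : Matrix n n ℂ →⋆ₙₐ[ℂ] Matrix (m × n) (m × n) ℂ :=
    { toFun := fun A => (1 : Matrix m m ℂ) ⊗ₖ A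
      map_smul' := fun c A => Matrix.kronecker_smul c 1 A
      map_zero' := Matrix.kronecker_zero _
      map_add' := fun A B => Matrix.kronecker_add 1 A B
      map_mul' := fun A B => by rw [← Matrix.mul_kronecker_mul, Matrix.one_mul]
      map_star' := fun A => by
        simp only [Matrix.star_eq_conjTranspose]
        rw [Matrix.conjTranspose_kronecker, Matrix.conjTranspose_one] }
  have h : A ⊗ₖ B = f A * g B := by
    change _ = (A ⊗ₖ (1 : Matrix n n ℂ)) * ((1 : Matrix m m ℂ) ⊗ₖ B)
    rw [← Matrix.mul_kronecker_mul, Matrix.one_mul, Matrix.mul_one]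
  rw [h]
  exact (norm_mul_le _ _).trans (mul_le_mul (NonUnitalStarAlgHom.norm_apply_le f A)
    (NonUnitalStarAlgHom.norm_apply_le g B) (norm_nonneg _) (norm_nonneg _))

/-- The norm of `M_1(M_d)` is that of `M_d`. -/
theorem blockNorm_of_subsingleton {ι : Type*} [Fintype ι] [DecidableEq ι] [Subsingleton ι]
    [Nonempty ι] {d : ℕ}
    (M : Matrix (Fin d) (Fin d) ℂ) : blockNorm (Matrix.of fun _ _ : ι => M) = ‖M‖ₑ := by
  rw [blockNorm_eq_enorm_comp, ← ofReal_norm, ← ofReal_norm]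
  congr 1
  apply le_antisymm
  · exact l2_opNorm_submatrix_le M (f := (Prod.snd : ι × Fin d → Fin d)) (g := Prod.snd)
      (fun a b h => Prod.ext (Subsingleton.elim _ _) h)
      (fun a b h => Prod.ext (Subsingleton.elim _ _) h)
  · exact l2_opNorm_submatrix_le
      (Matrix.comp ι ι (Fin d) (Fin d) ℂ (Matrix.of fun _ _ : ι => M))
      (f := fun i => (Classical.arbitrary ι, i)) (g := fun i => (Classical.arbitrary ι, i))
      (fun a b h => congrArg Prod.snd h) (fun a b h => congrArg Prod.snd h)

theorem blockNorm_smul {ι : Type*} [Fintype ι] [DecidableEq ι] {d : ℕ} (c : ℂ)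
    (X : Matrix ι ι (Matrix (Fin d) (Fin d) ℂ)) : blockNorm (c • X) = ‖c‖ₑ * blockNorm X := by
  rw [blockNorm_eq_enorm_comp, blockNorm_eq_enorm_comp, ← enorm_smul]
  rfl

theorem norm_unitary_le_one {d : ℕ} (U : Matrix.unitaryGroup (Fin d) ℂ) :
    ‖(U : Matrix (Fin d) (Fin d) ℂ)‖ ≤ 1 := by
  rcases isEmpty_or_nonempty (Fin d) with _ | _
  · rw [Subsingleton.elim (U : Matrix (Fin d) (Fin d) ℂ) 0, norm_zero]; exact zero_le_one
  · exact (CStarRing.norm_of_mem_unitary U.2).le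

/-! ### Compressions of operators -/

section compress

variable {H : Type*} [NormedAddCommGroup H] [InnerProductSpace ℂ H]

/-- The compression of an operator on `H` by a finite family of vectors. -/
def compress {m : ℕ} (v : Fin m → H) : (H →L[ℂ] H) →L[ℂ] Matrix (Fin m) (Fin m) ℂ where
  toFun T := Matrix.of fun k l => ⟪v k, T (v l)⟫_ℂ
  map_add' S T := by ext; simp
  map_smul' c T := by ext; simp
  cont := by
    refine continuous_pi fun k => continuous_pi fun l => ?_
    exact continuous_const.inner (ContinuousLinearMap.apply ℂ H (v l)).continuous

theorem compress_apply {m : ℕ} (v : Fin m → H) (T : H →L[ℂ] H) (k l : Fin m) :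
    compress v T k l = ⟪v k, T (v l)⟫_ℂ := rfl

/-- The vector of `ℓ²(ι; H)` with coordinates `∑ k, a (i, k) • v k`. -/
def expand {ι : Type*} [Fintype ι] {m : ℕ} (v : Fin m → H) (a : EuclideanSpace ℂ (ι × Fin m)) :
    PiLp 2 (fun _ : ι => H) :=
  WithLp.toLp 2 fun i => ∑ k, a (i, k) • v k

theorem inner_expand {ι : Type*} [Fintype ι] {m : ℕ} {v : Fin m → H} (hv : Orthonormal ℂ v)
    (a b : EuclideanSpace ℂ (ι × Fin m)) : ⟪expand v a, expand v b⟫_ℂ = ⟪a, b⟫_ℂ := by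
  rw [PiLp.inner_apply, PiLp.inner_apply, Fintype.sum_prod_type]
  refine Finset.sum_congr rfl fun i _ => ?_
  simp only [expand]
  rw [hv.inner_sum]
  refine Finset.sum_congr rfl fun k _ => ?_
  simp [mul_comm]

theorem norm_expand {ι : Type*} [Fintype ι] {m : ℕ} {v : Fin m → H} (hv : Orthonormal ℂ v)
    (a : EuclideanSpace ℂ (ι × Fin m)) : ‖expand v a‖ = ‖a‖ := by
  rw [@norm_eq_sqrt_re_inner ℂ, @norm_eq_sqrt_re_inner ℂ, inner_expand hv]

theorem blockOp_apply {ι : Type*} [Fintype ι] (T : Matrix ι ι (H →L[ℂ] H))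
    (x : PiLp 2 (fun _ : ι => H)) (i : ι) : blockOp T x i = ∑ j, T i j (x j) := by
  simp [blockOp]

/-- With `V = expand v`, the compressed matrix is `V* T V`. This identity needs no orthonormality;
that enters only to make `V` isometric. -/
theorem inner_blockOp_expand {ι : Type*} [Fintype ι] [DecidableEq ι] {m : ℕ} (v : Fin m → H)
    (T : Matrix ι ι (H →L[ℂ] H)) (a b : EuclideanSpace ℂ (ι × Fin m)) :
    ⟪expand v a, blockOp T (expand v b)⟫_ℂ =
      ⟪a, Matrix.toEuclideanCLM (𝕜 := ℂ)
        (Matrix.comp ι ι (Fin m) (Fin m) ℂ (T.map (compress v))) b⟫_ℂ := by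
  rw [PiLp.inner_apply, PiLp.inner_apply, Fintype.sum_prod_type]
  refine Finset.sum_congr rfl fun i _ => ?_
  rw [blockOp_apply]
  simp only [expand, sum_inner, inner_smul_left]
  refine Finset.sum_congr rfl fun k _ => ?_
  rw [Matrix.ofLp_toEuclideanCLM, Matrix.mulVec, dotProduct, Fintype.sum_prod_type]
  simp only [map_sum, map_smul, inner_sum, inner_smul_right, Matrix.comp_apply, Matrix.map_apply,
    compress_apply, RCLike.inner_apply, Finset.sum_mul, Finset.mul_sum]
  refine Finset.sum_congr rfl fun j _ => Finset.sum_congr rfl fun l _ => ?_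
  ring

theorem blockNorm_compress_le {ι : Type*} [Fintype ι] [DecidableEq ι] {m : ℕ} {v : Fin m → H}
    (hv : Orthonormal ℂ v) (T : Matrix ι ι (H →L[ℂ] H)) :
    blockNorm (T.map (compress v)) ≤ ‖blockOp T‖ₑ := by
  rw [blockNorm, ← ofReal_norm, ← ofReal_norm]
  refine ENNReal.ofReal_le_ofReal (ContinuousLinearMap.opNorm_le_of_re_inner_le (𝕜 := ℂ)
    (norm_nonneg _) fun x y hx hy => ?_)
  rw [← inner_conj_symm, ← inner_blockOp_expand]
  refine (RCLike.re_le_norm _).trans ?_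
  rw [RCLike.norm_conj]
  refine (norm_inner_le_norm _ _).trans ?_
  rw [norm_expand hv, hy, one_mul]
  refine (ContinuousLinearMap.le_opNorm _ _).trans ?_
  rw [norm_expand hv, hx, mul_one]

/-- The finitely many coordinates of `x` and `y` span a finite-dimensional subspace of `H`; an
orthonormal basis of it serves both vectors. -/
theorem exists_orthonormal_expand {ι : Type*} [Fintype ι] (x y : PiLp 2 (fun _ : ι => H)) :
    ∃ (m : ℕ) (v : Fin m → H), Orthonormal ℂ v ∧
      ∃ a b : EuclideanSpace ℂ (ι × Fin m), expand v a = x ∧ expand v b = y := by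
  let W : Submodule ℂ H := Submodule.span ℂ (Set.range x ∪ Set.range y)
  have : FiniteDimensional ℂ W :=
    FiniteDimensional.span_of_finite ℂ ((Set.finite_range _).union (Set.finite_range _))
  let w := stdOrthonormalBasis ℂ W
  have key : ∀ z : PiLp 2 (fun _ : ι => H), (∀ i, z i ∈ W) →
      ∃ a : EuclideanSpace ℂ (ι × Fin (Module.finrank ℂ W)), expand (fun k => (w k : H)) a = z := by
    intro z hz
    refine ⟨WithLp.toLp 2 fun p => w.repr ⟨z p.1, hz p.1⟩ p.2, ?_⟩
    ext i
    have := congrArg (Subtype.val) (w.sum_repr ⟨z i, hz i⟩)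
    simpa [expand] using this
  obtain ⟨a, ha⟩ := key x fun i => Submodule.subset_span (Or.inl ⟨i, rfl⟩)
  obtain ⟨b, hb⟩ := key y fun i => Submodule.subset_span (Or.inr ⟨i, rfl⟩)
  exact ⟨_, fun k => (w k : H), w.orthonormal.comp_linearIsometry W.subtypeₗᵢ, a, b, ha, hb⟩

/-- The operator norm is tested on one pair of unit vectors at a time, and a single compression sees
each pair. -/
theorem enorm_blockOp_le {ι : Type*} [Fintype ι] [DecidableEq ι] (T : Matrix ι ι (H →L[ℂ] H))
    {C : ℝ≥0∞}
    (h : ∀ (m : ℕ) (v : Fin m → H), Orthonormal ℂ v → blockNorm (T.map (compress v)) ≤ C) :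
    ‖blockOp T‖ₑ ≤ C := by
  rcases eq_or_ne C ∞ with rfl | hC
  · exact le_top
  rw [← ofReal_norm]
  refine ENNReal.ofReal_le_of_le_toReal ?_
  refine ContinuousLinearMap.opNorm_le_of_re_inner_le (𝕜 := ℂ) ENNReal.toReal_nonneg
    fun x y hx hy => ?_
  obtain ⟨m, v, hv, a, b, rfl, rfl⟩ := exists_orthonormal_expand x y
  rw [← inner_conj_symm, inner_blockOp_expand]
  refine (RCLike.re_le_norm _).trans ?_
  rw [RCLike.norm_conj]
  refine (norm_inner_le_norm _ _).trans ?_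
  rw [← norm_expand hv b, hy, one_mul]
  refine (ContinuousLinearMap.le_opNorm _ _).trans ?_
  rw [← norm_expand hv a, hx, mul_one]
  have := h m v hv
  rw [blockNorm, ← ofReal_norm] at this
  exact (ENNReal.ofReal_le_iff_le_toReal hC).1 this

end compress

/-! ### Norms of vectors -/

theorem sInfNorm_vec (d : ℕ) (M : Matrix (Fin d) (Fin d) ℂ) : (sInfNorm d).vec M = ‖M‖ₑ :=
  blockNorm_of_subsingleton M

/-- A completely bounded map is bounded; the norm of the source may be replaced by a larger
homogeneous function. -/
theorem vec_map_le_cbNorm_mul {V W : Type*} [AddCommGroup V] [Module ℂ V] [AddCommGroup W]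
    [Module ℂ W] {NV : MatNorm V} {NW : MatNorm W} {u : V →ₗ[ℂ] W} {p : V → ℝ≥0∞}
    (hp : ∀ v, NV.vec v ≤ p v) (hp_smul : ∀ (c : ℂ) v, p (c • v) ≤ ‖c‖ₑ * p v)
    (hW : ∀ (c : ℂ) w, NW.vec (c • w) ≤ ‖c‖ₑ * NW.vec w) (hu : cbNorm NV NW u ≠ ∞)
    (v : V) (hv : p v ≠ ∞) : NW.vec (u v) ≤ cbNorm NV NW u * p v := by
  have key : ∀ w, p w ≤ 1 → NW.vec (u w) ≤ cbNorm NV NW u := fun w hw =>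
    le_iSup_of_le 1 (le_iSup_of_le (Matrix.of fun _ _ => w)
      (le_iSup_of_le ((hp w).trans hw) le_rfl))
  lift cbNorm NV NW u to NNReal using hu with K
  lift p v to NNReal using hv with t ht
  refine ENNReal.le_of_forall_pos_le_add fun ε hε _ => ?_
  -- Dividing by `s > p v` stays meaningful when `p v = 0`; the excess costs `K ε / (K + 1) ≤ ε` in
  -- the final bound.
  set s : NNReal := t + ε / (K + 1) with hs
  have hδ : 0 < ε / (K + 1) := div_pos hε (by positivity)
  have hs0 : 0 < s := by positivity
  have hsC : ((s : ℝ) : ℂ) ≠ 0 := by exact_mod_cast hs0.ne'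
  have hns : ‖((s : ℝ) : ℂ)‖ₑ = s := by
    rw [← ofReal_norm, Complex.norm_real, Real.norm_eq_abs, NNReal.abs_eq, ENNReal.ofReal_coe_nnreal]
  have h1 : NW.vec (u (((s : ℝ) : ℂ)⁻¹ • v)) ≤ K := by
    refine key _ ((hp_smul _ _).trans ?_)
    rw [enorm_inv hsC, hns, ← ht, ← ENNReal.coe_inv hs0.ne', ← ENNReal.coe_mul]
    refine ENNReal.coe_le_one_iff.2 ?_
    rw [inv_mul_le_one₀ hs0]
    exact le_self_add
  have h2 : NW.vec (u v) ≤ s * K := by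
    have h3 : u v = ((s : ℝ) : ℂ) • u (((s : ℝ) : ℂ)⁻¹ • v) := by
      rw [map_smul, smul_inv_smul₀ hsC]
    rw [h3]
    refine (hW _ _).trans ?_
    rw [hns]
    gcongr
  refine h2.trans ?_
  rw [← ENNReal.coe_mul, ← ENNReal.coe_mul, ← ENNReal.coe_add]
  refine ENNReal.coe_le_coe.2 ?_
  rw [hs, add_mul, mul_comm t K]
  gcongr
  rw [div_mul_eq_mul_div]
  refine div_le_of_le_mul₀ (by positivity) (by positivity) ?_
  gcongr
  exact le_self_add

section vec

variable {H : Type*} [NormedAddCommGroup H] [InnerProductSpace ℂ H]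
    {E : Type*} [NormedAddCommGroup E] [NormedSpace ℂ E] (J : E →ₗᵢ[ℂ] (H →L[ℂ] H))

theorem norm_blockOp_of_unique {ι : Type*} [Fintype ι] [Unique ι] (T : H →L[ℂ] H) :
    ‖blockOp (Matrix.of fun _ _ : ι => T)‖ = ‖T‖ := by
  have hn : ∀ x : PiLp 2 (fun _ : ι => H), ‖x‖ = ‖x default‖ := fun x => by
    rw [PiLp.norm_eq_of_L2]; simp
  apply le_antisymm
  · refine ContinuousLinearMap.opNorm_le_bound _ (norm_nonneg _) fun x => ?_
    rw [hn, hn x, blockOp_apply]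
    simpa using T.le_opNorm (x default)
  · refine ContinuousLinearMap.opNorm_le_bound _
      (norm_nonneg (blockOp (Matrix.of fun _ _ : ι => T))) fun x => ?_
    have := (blockOp (Matrix.of fun _ _ : ι => T)).le_opNorm (WithLp.toLp 2 fun _ => x)
    rw [hn, hn (WithLp.toLp 2 fun _ => x), blockOp_apply] at this
    simpa using this

theorem opNorm_vec (e : E) : (opNorm J).vec e = ‖e‖ₑ := by
  have h := norm_blockOp_of_unique (ι := Fin 1) (J e)
  rw [J.norm_map] at h
  rw [← ofReal_norm e, ← h]
  exact (ofReal_norm (blockOp (Matrix.of fun _ _ : Fin 1 => J e))).symm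

theorem lInfNorm_vec {G : Type*} [MeasurableSpace G] (μ : Measure G) (F : Lp E ∞ μ) :
    (lInfNorm μ J).vec F = ‖F‖ₑ := by
  rw [Lp.enorm_def, eLpNorm_exponent_top, eLpNormEssSup]
  exact congrArg (fun f => essSup f μ) (funext fun g => opNorm_vec J (F g))

variable {J} in
theorem lInfNorm_vec_smul_le {G : Type*} [MeasurableSpace G] {μ : Measure G} (c : ℂ)
    (F : Lp E ∞ μ) :
    (lInfNorm μ J).vec (c • F) ≤ ‖c‖ₑ * (lInfNorm μ J).vec F := by
  rw [lInfNorm_vec, lInfNorm_vec, enorm_smul]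

/-! ### Trace functionals -/

/-- The map `A ↦ tr (A u)` on `M_d(E)`. -/
def traceMul {d : ℕ} (u : Matrix (Fin d) (Fin d) ℂ) : Matrix (Fin d) (Fin d) E →ₗ[ℂ] E where
  toFun A := ∑ i, ∑ j, u j i • A i j
  map_add' A B := by simp [Finset.sum_add_distrib]
  map_smul' c A := by simp [Finset.smul_sum, smul_comm c]

theorem traceMul_apply {d : ℕ} (u : Matrix (Fin d) (Fin d) ℂ) (A : Matrix (Fin d) (Fin d) E) :
    traceMul u A = ∑ i, ∑ j, u j i • A i j := rfl

/-- The linear map `B ⊗ e ↦ tr (B u) • compress v (J e)`. -/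
def traceCompress {d m : ℕ} (u : Matrix (Fin d) (Fin d) ℂ) (v : Fin m → H) :
    Matrix (Fin d) (Fin d) ℂ ⊗[ℂ] E →ₗ[ℂ] Matrix (Fin m) (Fin m) ℂ :=
  TensorProduct.lift (LinearMap.mk₂ ℂ (fun B e => (B * u).trace • compress v (J e))
    (fun B C e => by rw [Matrix.add_mul, Matrix.trace_add, add_smul])
    (fun c B e => by rw [Matrix.smul_mul, Matrix.trace_smul, smul_assoc])
    (fun B e f => by rw [map_add, map_add, smul_add])
    (fun c B e => by rw [map_smul, map_smul, smul_comm]))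

theorem traceCompress_tmul {d m : ℕ} (u : Matrix (Fin d) (Fin d) ℂ) (v : Fin m → H)
    (B : Matrix (Fin d) (Fin d) ℂ) (e : E) :
    traceCompress J u v (B ⊗ₜ e) = (B * u).trace • compress v (J e) := rfl

theorem traceCompress_toTensor {d m : ℕ} (u : Matrix (Fin d) (Fin d) ℂ) (v : Fin m → H)
    (A : Matrix (Fin d) (Fin d) E) :
    traceCompress J u v (toTensor d E A) = compress v (J (traceMul u A)) := by
  have h : toTensor d E A = ∑ i, ∑ j, Matrix.single i j (1 : ℂ) ⊗ₜ[ℂ] A i j := rfl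
  rw [h, traceMul_apply]
  simp only [map_sum, map_smul, traceCompress_tmul, Matrix.trace_single_mul, one_smul]

theorem enorm_tracePairing_le {d p : ℕ} (x : Matrix (Fin p) (Fin p) (Matrix (Fin d) (Fin d) ℂ))
    {u : Matrix (Fin d) (Fin d) ℂ} (hu : ‖u‖ₑ ≤ 1) : ‖tracePairing x u‖ₑ ≤ sOneNorm d p x := by
  refine le_iSup_of_le 1 (le_iSup_of_le (Matrix.of fun _ _ => u) (le_iSup_of_le ?_ ?_))
  · exact (sInfNorm_vec d u).le.trans hu
  · exact (sInfNorm_vec p (tracePairing x u)).ge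

/-- Up to reassociating indices, the matrix of values is the Kronecker product of `(tr (x_ij u))`
with the compression of `y`. -/
theorem jointlyCC_traceCompress {d m : ℕ} {u : Matrix (Fin d) (Fin d) ℂ} (hu : ‖u‖ₑ ≤ 1)
    {v : Fin m → H} (hv : Orthonormal ℂ v) :
    JointlyCC (sOneNorm d) (opNorm J) (traceCompress J u v) := by
  intro p q x y
  refine le_trans ?_ (mul_le_mul' (enorm_tracePairing_le x hu) (blockNorm_compress_le hv (y.map J)))
  rw [blockNorm_eq_enorm_comp, blockNorm_eq_enorm_comp, ← ofReal_norm, ← ofReal_norm,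
    ← ofReal_norm, ← ENNReal.ofReal_mul (norm_nonneg _)]
  refine ENNReal.ofReal_le_ofReal (le_trans (le_of_eq_of_le ?_ (l2_opNorm_submatrix_le _
    (Equiv.prodAssoc (Fin p) (Fin q) (Fin m)).injective
    (Equiv.prodAssoc (Fin p) (Fin q) (Fin m)).injective)) (l2_opNorm_kronecker_le _ _))
  rfl

/-- `A ↦ compress v (J (tr (A u)))` is a complete contraction on `S^1_d(E)`. -/
theorem cbNorm_traceCompress_le {d m : ℕ} {u : Matrix (Fin d) (Fin d) ℂ} (hu : ‖u‖ₑ ≤ 1)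
    {v : Fin m → H} (hv : Orthonormal ℂ v) :
    cbNorm (sOneNormE J d) (sInfNorm m) (traceCompress J u v ∘ₗ toTensor d E) ≤ 1 := by
  refine iSup_le fun n => iSup_le fun X => iSup_le fun hX => le_trans ?_ hX
  -- `traceCompress J u v` is one of the forms over which the projective norm takes its supremum.
  exact le_iSup_of_le m (le_iSup_of_le (traceCompress J u v)
    (le_iSup_of_le (jointlyCC_traceCompress J hu hv) le_rfl))

theorem enorm_traceMul_le {d : ℕ} {u : Matrix (Fin d) (Fin d) ℂ} (hu : ‖u‖ₑ ≤ 1)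
    (A : Matrix (Fin d) (Fin d) E) : ‖traceMul u A‖ₑ ≤ (sOneNormE J d).vec A := by
  rw [← opNorm_vec J]
  refine enorm_blockOp_le _ fun m v hv => ?_
  refine le_iSup_of_le m (le_iSup_of_le (traceCompress J u v)
    (le_iSup_of_le (jointlyCC_traceCompress J hu hv) (le_of_eq ?_)))
  congr 1
  exact Matrix.ext fun i j => (traceCompress_toTensor J u v A).symm

/-! ### Finiteness of the norms -/

/-- As `tr (e_ij B) = B_ji`, the associated map on `M_n(M_d)` extracts a submatrix, which is
contractive at every level `n`. -/
theorem sOneNorm_vec_single_le {d : ℕ} (i j : Fin d) :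
    (sOneNorm d).vec (Matrix.single i j 1) ≤ 1 := by
  refine iSup_le fun n => iSup_le fun X => iSup_le fun hX => le_trans ?_ hX
  rw [sInfNorm, sInfNorm, blockNorm_eq_enorm_comp, blockNorm_eq_enorm_comp, ← ofReal_norm,
    ← ofReal_norm]
  refine ENNReal.ofReal_le_ofReal (le_of_eq_of_le ?_ (l2_opNorm_submatrix_le _
    (f := fun a : Fin n × Fin 1 => (a.1, j)) (g := fun a : Fin n × Fin 1 => (a.1, i))
    (fun a b h => Prod.ext (congrArg (fun c : Fin n × Fin d => c.1) h) (Subsingleton.elim _ _))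
    (fun a b h => Prod.ext (congrArg (fun c : Fin n × Fin d => c.1) h) (Subsingleton.elim _ _))))
  congr 1
  ext a b
  simp [tracePairing, Matrix.comp_apply, Matrix.trace_single_mul]

theorem toTensor_single {d : ℕ} (i j : Fin d) (e : E) :
    toTensor d E (Matrix.single i j e) = Matrix.single i j (1 : ℂ) ⊗ₜ[ℂ] e := by
  have h : toTensor d E (Matrix.single i j e) =
    ∑ k, ∑ l, Matrix.single k l (1 : ℂ) ⊗ₜ[ℂ] (Matrix.single i j e : Matrix _ _ E) k l := rfl
  rw [h, Finset.sum_eq_single i, Finset.sum_eq_single j]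
  · simp
  · intro l _ hl; simp [hl.symm]
  · simp
  · intro k _ hk; simp [hk.symm]
  · simp

theorem sOneNormE_vec_single_le {d : ℕ} (i j : Fin d) (e : E) :
    (sOneNormE J d).vec (Matrix.single i j e) ≤ ‖e‖ₑ := by
  refine iSup_le fun m => iSup_le fun φ => iSup_le fun hφ => ?_
  have h := hφ 1 1 (Matrix.of fun _ _ => Matrix.single i j 1) (Matrix.of fun _ _ => e)
  have h1 := (blockNorm_of_subsingleton (ι := Fin 1 × Fin 1) (φ (Matrix.single i j 1 ⊗ₜ[ℂ] e))).ge.trans h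
  have h2 := blockNorm_of_subsingleton (ι := Fin 1) (φ (toTensor d E (Matrix.single i j e)))
  refine h2.le.trans ?_
  rw [toTensor_single]
  refine h1.trans ?_
  refine (mul_le_mul' (sOneNorm_vec_single_le i j) (opNorm_vec J e).le).trans ?_
  rw [one_mul]

theorem sOneNormE_vec_sum_le {ι : Type*} (d : ℕ) (s : Finset ι)
    (f : ι → Matrix (Fin d) (Fin d) E) :
    (sOneNormE J d).vec (∑ i ∈ s, f i) ≤ ∑ i ∈ s, (sOneNormE J d).vec (f i) := by
  refine Finset.le_sum_of_subadditive _ ?_ (sOneNormE_vec_add_le J d) s f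
  simpa using sOneNormE_vec_smul_le J d 0 0

/-- The norms take extended values, so finiteness has to be proved; expansion in matrix units
reduces it to elementary tensors. -/
theorem sOneNormE_vec_ne_top {d : ℕ} (A : Matrix (Fin d) (Fin d) E) :
    (sOneNormE J d).vec A ≠ ∞ := by
  rw [Matrix.matrix_eq_sum_single A]
  refine ne_top_of_le_ne_top ?_ (sOneNormE_vec_sum_le J d _ _)
  refine (ENNReal.sum_lt_top.2 fun i _ => ?_).ne
  refine (sOneNormE_vec_sum_le J d _ _).trans_lt ?_
  exact ENNReal.sum_lt_top.2 fun j _ => (sOneNormE_vec_single_le J i j _).trans_lt enorm_lt_top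

end vec

section group

variable {G : Type*} [Group G] [TopologicalSpace G]

theorem enorm_le_one_of_norm_le_one {V : Type*} [SeminormedAddCommGroup V] {x : V}
    (h : ‖x‖ ≤ 1) : ‖x‖ₑ ≤ 1 := by
  rw [← ofReal_norm]; exact ENNReal.ofReal_le_one.2 h

theorem DualObject.enorm_mat_le_one (π : DualObject G) (g : G) : ‖π.mat g‖ₑ ≤ 1 :=
  enorm_le_one_of_norm_le_one (norm_unitary_le_one (π.rep.hom g))

/-! ### The trivial representation -/

/-- The trivial representation. -/
def trivialRep (G : Type*) [Group G] [TopologicalSpace G] : IrredUnitaryRep G where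
  dim := 1
  dim_pos := one_pos
  hom := 1
  continuous_hom := continuous_const
  irreducible W _ := by
    have : IsSimpleModule ℂ (Fin 1 → ℂ) :=
      isSimpleModule_iff_finrank_eq_one.2 (by simp)
    exact eq_bot_or_eq_top W

/-- The class of the trivial representation. -/
def trivialClass (G : Type*) [Group G] [TopologicalSpace G] : DualObject G :=
  Quotient.mk _ (trivialRep G)

/-- The chosen representative is only unitarily equivalent to `trivialRep`, but conjugating the
identity returns the identity. -/
theorem trivialClass_mat (g : G) : (trivialClass G).mat g = 1 := by
  obtain ⟨U, -, h2, h3⟩ := (IrredUnitaryRep.setoid G).symm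
    (Quotient.mk_out (s := IrredUnitaryRep.setoid G) (trivialRep G))
  have h4 := h3 g
  rw [show (trivialRep G).mat g = 1 from rfl, Matrix.mul_one] at h4
  have h5 := congrArg (· * U.conjTranspose) h4
  simp only [Matrix.mul_assoc, h2, Matrix.mul_one] at h5
  exact h5.symm

/-- The two degrees are the traces of `U Uᴴ` and `Uᴴ U`. -/
theorem trivialClass_deg : (trivialClass G).deg = 1 := by
  obtain ⟨U, h1, h2, -⟩ := (IrredUnitaryRep.setoid G).symm
    (Quotient.mk_out (s := IrredUnitaryRep.setoid G) (trivialRep G))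
  have h := Matrix.trace_mul_comm U U.conjTranspose
  rw [h1, h2, Matrix.trace_one, Matrix.trace_one, Fintype.card_fin, Fintype.card_fin] at h
  exact_mod_cast h

end group

variable {G : Type*} [Group G] [TopologicalSpace G]
  {H : Type*} [NormedAddCommGroup H] [InnerProductSpace ℂ H]
  {E : Type*} [NormedAddCommGroup E] [NormedSpace ℂ E] (J : E →ₗᵢ[ℂ] (H →L[ℂ] H))

/-! ### The Banach space norm of `L^1_E(Ĝ)` -/

/-- `∑_π d_π ‖A^π‖_{S^1(E)}`. -/
def l1Size (A : MSpace G E) : ℝ≥0∞ :=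
  ∑' π : DualObject G, (π.deg : ℝ≥0∞) * (sOneNormE J π.deg).vec (A π)

theorem l1Size_ne_top (A : L1Hat G J) : l1Size J (A : MSpace G E) ≠ ∞ := A.2.ne

theorem summable_toReal_l1Size (A : L1Hat G J) : Summable fun π : DualObject G =>
    ((π.deg : ℝ≥0∞) * (sOneNormE J π.deg).vec ((A : MSpace G E) π)).toReal :=
  ENNReal.summable_toReal (l1Size_ne_top J A)

theorem l1Size_smul_le (c : ℂ) (A : MSpace G E) : l1Size J (c • A) ≤ ‖c‖ₑ * l1Size J A := by
  rw [l1Size, l1Size, ← ENNReal.tsum_mul_left]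
  refine ENNReal.tsum_le_tsum fun π => ?_
  rw [mul_left_comm]
  exact mul_le_mul_right (sOneNormE_vec_smul_le J _ _ _) _

theorem sOneNormE_vec_zero (d : ℕ) : (sOneNormE J d).vec 0 = 0 := by
  simpa using sOneNormE_vec_smul_le J d 0 0

theorem enorm_apply_le_of_cbNorm_le_one {d m : ℕ}
    {u : Matrix (Fin d) (Fin d) E →ₗ[ℂ] Matrix (Fin m) (Fin m) ℂ}
    (hu : cbNorm (sOneNormE J d) (sInfNorm m) u ≤ 1) (A : Matrix (Fin d) (Fin d) E) :
    ‖u A‖ₑ ≤ (sOneNormE J d).vec A := by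
  rw [← sInfNorm_vec]
  refine (vec_map_le_cbNorm_mul (p := (sOneNormE J d).vec) (fun _ => le_rfl)
    (sOneNormE_vec_smul_le J d) (fun c M => ?_) (ne_top_of_le_ne_top ENNReal.one_ne_top hu)
    A (sOneNormE_vec_ne_top J A)).trans (mul_le_of_le_one_left' hu)
  rw [sInfNorm_vec, sInfNorm_vec, enorm_smul]

/-- By the triangle inequality. This direction alone makes every completely bounded map continuous
for `l1Size`. -/
theorem l1HatNorm_vec_le (A : L1Hat G J) : (l1HatNorm G J).vec A ≤ l1Size J (A : MSpace G E) := by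
  refine iSup_le fun m => iSup_le fun u => iSup_le fun hu => ?_
  refine (blockNorm_of_subsingleton (ι := Fin 1)
    (∑' π : DualObject G, (π.deg : ℂ) • u π ((A : MSpace G E) π))).le.trans ?_
  refine enorm_tsum_le_tsum_enorm.trans (ENNReal.tsum_le_tsum fun π => ?_)
  rw [enorm_smul]
  refine mul_le_mul' (le_of_eq ?_) (enorm_apply_le_of_cbNorm_le_one J (hu π) _)
  rw [← ofReal_norm, Complex.norm_natCast, ENNReal.ofReal_natCast]

/-! ### The inverse Fourier transform -/

theorem invTerm_eq (A : MSpace G E) (g : G) (π : DualObject G) :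
    invTerm A g π = (π.deg : ℂ) • traceMul (π.mat g) (A π) := rfl

theorem enorm_invTerm_le (A : MSpace G E) (g : G) (π : DualObject G) :
    ‖invTerm A g π‖ₑ ≤ (π.deg : ℝ≥0∞) * (sOneNormE J π.deg).vec (A π) := by
  rw [invTerm_eq, enorm_smul]
  refine mul_le_mul' (le_of_eq ?_) (enorm_traceMul_le J (π.enorm_mat_le_one g) _)
  rw [← ofReal_norm, Complex.norm_natCast, ENNReal.ofReal_natCast]

theorem norm_invTerm_le (A : MSpace G E) (g : G) (π : DualObject G) :
    ‖invTerm A g π‖ ≤ ((π.deg : ℝ≥0∞) * (sOneNormE J π.deg).vec (A π)).toReal := by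
  rw [← toReal_enorm]
  refine ENNReal.toReal_mono ?_ (enorm_invTerm_le J A g π)
  exact ENNReal.mul_ne_top (ENNReal.natCast_ne_top _) (sOneNormE_vec_ne_top J _)

theorem summable_invTerm [CompleteSpace E] (A : L1Hat G J) (g : G) :
    Summable (invTerm (A : MSpace G E) g) := by
  have h := norm_invTerm_le J (A : MSpace G E) g
  exact Summable.of_norm_bounded (summable_toReal_l1Size J A) h

theorem summable_invTerm_of_memL1Hat {B : MSpace G ℂ} (hB : MemL1Hat B) (g : G) :
    Summable (invTerm B g) := by
  refine Summable.of_norm_bounded (ENNReal.summable_toReal hB.ne) fun π => ?_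
  rw [← toReal_enorm]
  refine ENNReal.toReal_mono (ENNReal.ne_top_of_tsum_ne_top hB.ne π) ?_
  rw [invTerm, enorm_smul]
  refine mul_le_mul' (le_of_eq ?_) ?_
  · rw [← ofReal_norm, Complex.norm_natCast, ENNReal.ofReal_natCast]
  · refine le_trans (le_of_eq ?_) (enorm_tracePairing_le (Matrix.of fun _ _ : Fin 1 => B π)
      (π.enorm_mat_le_one g))
    -- The pairing takes values in `1 × 1` matrices, whose norm is the modulus of the only entry.
    have h : tracePairing (Matrix.of fun _ _ : Fin 1 => B π) (π.mat g) =
        Matrix.diagonal fun _ => ∑ i, ∑ j, π.mat g j i • B π i j := by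
      ext a b
      rw [Subsingleton.elim a b, Matrix.diagonal_apply_eq]
      simp [tracePairing, Matrix.trace, Matrix.mul_apply, mul_comm]
    rw [h, ← ofReal_norm, ← ofReal_norm, Matrix.l2_opNorm_diagonal, pi_norm_const]

/-- Weierstrass M-test: the majorant of the terms does not depend on `g`. -/
theorem continuous_tsum_invTerm [CompleteSpace E] (A : L1Hat G J) :
    Continuous fun g => ∑' π, invTerm (A : MSpace G E) g π := by
  refine continuous_tsum (fun π => ?_) (summable_toReal_l1Size J A)
    fun π g => norm_invTerm_le J (A : MSpace G E) g π
  refine continuous_const.smul (continuous_finsetSum _ fun i _ => continuous_finsetSum _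
    fun j _ => (π.continuous_mat_apply j i).smul continuous_const)

theorem memLp_tsum_invTerm [CompleteSpace E] [CompactSpace G] [MeasurableSpace G] [BorelSpace G]
    (μ : Measure G) (A : L1Hat G J) : MemLp (fun g => ∑' π, invTerm (A : MSpace G E) g π) ∞ μ :=
  (continuous_tsum_invTerm J A).memLp_top_of_hasCompactSupport
    (HasCompactSupport.of_compactSpace _) μ

/-- The inverse Fourier transform `L^1_E(Ĝ) → L^∞_E(G)`. -/
def invFourier [CompleteSpace E] [CompactSpace G] [MeasurableSpace G] [BorelSpace G]
    (μ : Measure G) : L1Hat G J →ₗ[ℂ] Lp E ∞ μ where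
  toFun A := (memLp_tsum_invTerm J μ A).toLp _
  map_add' A B := by
    rw [← MemLp.toLp_add]
    refine MemLp.toLp_congr _ _ (Eventually.of_forall fun g => ?_)
    rw [Pi.add_apply, ← (summable_invTerm J A g).tsum_add (summable_invTerm J B g)]
    refine tsum_congr fun π => ?_
    rw [invTerm_eq, invTerm_eq, invTerm_eq, ← smul_add, ← map_add]
    rfl
  map_smul' c A := by
    rw [RingHom.id_apply, ← MemLp.toLp_const_smul]
    refine MemLp.toLp_congr _ _ (Eventually.of_forall fun g => ?_)
    rw [Pi.smul_apply, ← (summable_invTerm J A g).tsum_const_smul c]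
    refine tsum_congr fun π => ?_
    rw [invTerm_eq, invTerm_eq, smul_comm c, ← map_smul (traceMul (π.mat g)) c]
    rfl

theorem invFourier_ae_eq [CompleteSpace E] [CompactSpace G] [MeasurableSpace G] [BorelSpace G]
    (μ : Measure G) (A : L1Hat G J) :
    ⇑(invFourier J μ A) =ᵐ[μ] fun g => ∑' π, invTerm (A : MSpace G E) g π :=
  (memLp_tsum_invTerm J μ A).coeFn_toLp

/-- After compression by `v`, the sum at `g` is the pairing of `X` with the family `A ↦ compress v
(J (tr (A π(g))))`, which competes in the supremum defining `l1HatNorm`. -/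
theorem opNorm_tsum_invTerm_le [CompleteSpace E] {n : ℕ} (X : Matrix (Fin n) (Fin n) (L1Hat G J))
    (g : G) :
    opNorm J n (Matrix.of fun i j => ∑' π, invTerm (X i j : MSpace G E) g π) ≤
      l1HatNorm G J n X := by
  refine enorm_blockOp_le _ fun m v hv => ?_
  refine le_iSup_of_le m (le_iSup_of_le
    (fun π => traceCompress J (π.mat g) v ∘ₗ toTensor π.deg E) (le_iSup_of_le
      (fun π => cbNorm_traceCompress_le J (π.enorm_mat_le_one g) hv) (le_of_eq ?_)))
  congr 1
  refine Matrix.ext fun i j => ?_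
  change (compress v ∘L J.toContinuousLinearMap) (∑' π, invTerm (X i j : MSpace G E) g π) = _
  rw [ContinuousLinearMap.map_tsum _ (summable_invTerm J (X i j) g)]
  refine tsum_congr fun π => ?_
  rw [invTerm_eq, map_smul, LinearMap.comp_apply, traceCompress_toTensor]
  rfl

theorem cbNorm_invFourier_le [CompleteSpace E] [CompactSpace G] [MeasurableSpace G] [BorelSpace G]
    (μ : Measure G) : cbNorm (l1HatNorm G J) (lInfNorm μ J) (invFourier J μ) ≤ 1 := by
  refine iSup_le fun n => iSup_le fun X => iSup_le fun hX => ?_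
  refine essSup_le_of_ae_le _ ?_
  -- A matrix has finitely many entries, so one null set serves them all.
  have h : ∀ᵐ g ∂μ, ∀ i j,
      invFourier J μ (X i j) g = ∑' π, invTerm (X i j : MSpace G E) g π :=
    ae_all_iff.2 fun i => ae_all_iff.2 fun j => invFourier_ae_eq J μ (X i j)
  filter_upwards [h] with g hg
  refine le_trans (le_of_eq ?_) ((opNorm_tsum_invTerm_le J X g).trans hX)
  congr 1
  exact Matrix.ext fun i j => hg i j

theorem isCbExtension_invFourier [CompleteSpace E] [CompactSpace G] [MeasurableSpace G]
    [BorelSpace G] (μ : Measure G) : IsCbExtension μ J (invFourier J μ) := by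
  refine ⟨fun B e A hB hA => ?_, (cbNorm_invFourier_le J μ).trans_lt ENNReal.one_lt_top⟩
  filter_upwards [invFourier_ae_eq J μ A] with g hg
  rw [hg, hA, ← (summable_invTerm_of_memL1Hat hB g).tsum_smul_const]
  refine tsum_congr fun π => ?_
  simp only [invTerm, elemTensor, Matrix.map_apply, smul_eq_mul, Finset.sum_smul, mul_smul,
    Finset.smul_sum, Finset.mul_sum]

/-! ### Density of the finitely supported elements -/

open Classical in
/-- The element of `L^1_E(Ĝ)` supported at `π`. -/
def hatSingle (π : DualObject G) : Matrix (Fin π.deg) (Fin π.deg) E →ₗ[ℂ] L1Hat G J :=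
  (LinearMap.single ℂ (fun π : DualObject G => Matrix (Fin π.deg) (Fin π.deg) E) π).codRestrict
    (L1Hat G J) fun M => by
      change ∑' ρ : DualObject G, _ < ∞
      rw [tsum_eq_single π]
      · exact ENNReal.mul_lt_top (ENNReal.natCast_lt_top _) (sOneNormE_vec_ne_top J _).lt_top
      · intro ρ hρ
        rw [LinearMap.single_apply, Pi.single_eq_of_ne hρ, sOneNormE_vec_zero, mul_zero]

open Classical in
theorem coe_hatSingle (π : DualObject G) (M : Matrix (Fin π.deg) (Fin π.deg) E) :
    (hatSingle J π M : MSpace G E) = Pi.single π M := rfl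

theorem l1Size_hatSingle (π : DualObject G) (M : Matrix (Fin π.deg) (Fin π.deg) E) :
    l1Size J (hatSingle J π M : MSpace G E) = π.deg * (sOneNormE J π.deg).vec M := by
  classical
  rw [l1Size, tsum_eq_single π, coe_hatSingle, Pi.single_eq_same]
  intro ρ hρ
  rw [coe_hatSingle, Pi.single_eq_of_ne hρ, sOneNormE_vec_zero, mul_zero]

open Classical in
theorem memL1Hat_single (π : DualObject G) (i j : Fin π.deg) :
    MemL1Hat (Pi.single π (Matrix.single i j 1) : MSpace G ℂ) := by
  rw [MemL1Hat, tsum_eq_single π, Pi.single_eq_same]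
  · exact ENNReal.mul_lt_top (ENNReal.natCast_lt_top _)
      ((sOneNorm_vec_single_le i j).trans_lt ENNReal.one_lt_top)
  · intro ρ hρ
    rw [Pi.single_eq_of_ne hρ]
    have h : (sOneNorm ρ.deg).vec 0 = 0 := by
      refine le_antisymm (iSup_le fun n => iSup_le fun X => iSup_le fun _ => le_of_eq ?_) bot_le
      have h0 : X.map (tracePairing (Matrix.of fun _ _ : Fin 1 =>
          (0 : Matrix (Fin ρ.deg) (Fin ρ.deg) ℂ))) = (0 : ℂ) • 0 := by
        refine Matrix.ext fun a b => ?_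
        ext
        simp [tracePairing]
      rw [h0, sInfNorm, blockNorm_smul, enorm_zero, zero_mul]
    rw [h, mul_zero]

open Classical in
-- Matrix units turn one-class elements into sums of elementary tensors, where an extension is
-- prescribed.
theorem coe_hatSingle_single (π : DualObject G) (i j : Fin π.deg) (e : E) :
    (hatSingle J π (Matrix.single i j e) : MSpace G E) =
      elemTensor (Pi.single π (Matrix.single i j 1)) e := by
  rw [coe_hatSingle]
  funext ρ
  rcases eq_or_ne ρ π with rfl | hρ
  · ext a b
    simp only [elemTensor, Pi.single_eq_same, Matrix.map_apply, Matrix.single_apply]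
    split_ifs <;> simp
  · ext a b
    simp [elemTensor, Pi.single_eq_of_ne hρ]

/-- The truncation of `A` to a finite set of classes. -/
def truncate (A : L1Hat G J) (s : Finset (DualObject G)) : L1Hat G J :=
  ∑ π ∈ s, hatSingle J π ((A : MSpace G E) π)

open Classical in
theorem truncate_apply (A : L1Hat G J) (s : Finset (DualObject G)) (π : DualObject G) :
    (truncate J A s : MSpace G E) π = if π ∈ s then (A : MSpace G E) π else 0 := by
  rw [truncate, Submodule.coe_sum, Finset.sum_apply]
  exact Finset.sum_pi_single π (A : MSpace G E) s

/-- The size of the remainder is the tail of a convergent sum. -/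
theorem tendsto_l1Size_sub_truncate (A : L1Hat G J) :
    Tendsto (fun s => l1Size J ((A - truncate J A s : L1Hat G J) : MSpace G E)) atTop (𝓝 0) := by
  classical
  refine (ENNReal.tendsto_tsum_compl_atTop_zero (l1Size_ne_top J A)).congr fun s => ?_
  refine (tsum_subtype {π | π ∉ s} (fun π : DualObject G =>
    (π.deg : ℝ≥0∞) * (sOneNormE J π.deg).vec ((A : MSpace G E) π))).trans ?_
  refine tsum_congr fun π => ?_
  rw [Submodule.coe_sub, Pi.sub_apply, truncate_apply]
  by_cases h : π ∈ s
  · simp [h, sOneNormE_vec_zero]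
  · simp [h]

/-! ### Uniqueness of the completely bounded extension -/

variable [MeasurableSpace G] {μ : Measure G} {J}

theorem lInfNorm_vec_apply_le {Λ : L1Hat G J →ₗ[ℂ] Lp E ∞ μ}
    (hΛ : cbNorm (l1HatNorm G J) (lInfNorm μ J) Λ ≠ ∞) (A : L1Hat G J) :
    (lInfNorm μ J).vec (Λ A) ≤
      cbNorm (l1HatNorm G J) (lInfNorm μ J) Λ * l1Size J (A : MSpace G E) := by
  obtain ⟨p, hp⟩ : ∃ p : L1Hat G J → ℝ≥0∞, ∀ A, p A = l1Size J (A : MSpace G E) :=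
    ⟨_, fun _ => rfl⟩
  have h1 : ∀ A, (l1HatNorm G J).vec A ≤ p A := fun A => by
    rw [hp]; exact l1HatNorm_vec_le J A
  have h2 : ∀ (c : ℂ) A, p (c • A) ≤ ‖c‖ₑ * p A := fun c A => by
    rw [hp, hp]; exact l1Size_smul_le J c (A : MSpace G E)
  have h3 : p A ≠ ∞ := by
    rw [hp]; exact l1Size_ne_top J A
  rw [← hp]
  exact vec_map_le_cbNorm_mul h1 h2 lInfNorm_vec_smul_le hΛ A h3

theorem IsCbExtension.enorm_le {Λ : L1Hat G J →ₗ[ℂ] Lp E ∞ μ} (hΛ : IsCbExtension μ J Λ)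
    (A : L1Hat G J) :
    ‖Λ A‖ₑ ≤ cbNorm (l1HatNorm G J) (lInfNorm μ J) Λ * l1Size J (A : MSpace G E) := by
  have h := lInfNorm_vec_apply_le hΛ.2.ne A
  rwa [lInfNorm_vec] at h

theorem IsCbExtension.tendsto_truncate {Λ : L1Hat G J →ₗ[ℂ] Lp E ∞ μ} (hΛ : IsCbExtension μ J Λ)
    (A : L1Hat G J) : Tendsto (fun s => Λ (truncate J A s)) atTop (𝓝 (Λ A)) := by
  rw [tendsto_iff_edist_tendsto_0]
  have h := ENNReal.Tendsto.const_mul (tendsto_l1Size_sub_truncate J A) (Or.inr hΛ.2.ne)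
  rw [mul_zero] at h
  refine tendsto_of_tendsto_of_tendsto_of_le_of_le tendsto_const_nhds h (fun _ => bot_le)
    fun s => ?_
  change edist _ _ ≤ _
  rw [edist_comm, edist_eq_enorm_sub, ← map_sub]
  exact hΛ.enorm_le _

theorem IsCbExtension.apply_hatSingle_eq {Λ Λ' : L1Hat G J →ₗ[ℂ] Lp E ∞ μ}
    (hΛ : IsCbExtension μ J Λ) (hΛ' : IsCbExtension μ J Λ') (π : DualObject G)
    (M : Matrix (Fin π.deg) (Fin π.deg) E) : Λ (hatSingle J π M) = Λ' (hatSingle J π M) := by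
  classical
  rw [Matrix.matrix_eq_sum_single M]
  simp only [map_sum]
  refine Finset.sum_congr rfl fun i _ => Finset.sum_congr rfl fun j _ => Lp.ext ?_
  have h := coe_hatSingle_single J π i j (M i j)
  exact (hΛ.1 _ _ _ (memL1Hat_single π i j) h).trans
    (hΛ'.1 _ _ _ (memL1Hat_single π i j) h).symm

theorem IsCbExtension.unique {Λ Λ' : L1Hat G J →ₗ[ℂ] Lp E ∞ μ}
    (hΛ : IsCbExtension μ J Λ) (hΛ' : IsCbExtension μ J Λ') : Λ = Λ' := by
  refine LinearMap.ext fun A => tendsto_nhds_unique (hΛ.tendsto_truncate A) ?_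
  refine (hΛ'.tendsto_truncate A).congr fun s => ?_
  simp only [truncate, map_sum]
  exact Finset.sum_congr rfl fun π _ => (hΛ.apply_hatSingle_eq hΛ' π _).symm

/-! ### The lower bound -/

theorem traceMul_one_single {d : ℕ} (i : Fin d) (e : E) :
    traceMul 1 (Matrix.single i i e) = e := by
  rw [traceMul_apply, Finset.sum_eq_single i, Finset.sum_eq_single i]
  · simp
  · intro j _ hj; simp [hj.symm]
  · simp
  · intro k _ hk; simp [hk.symm]
  · simp

theorem one_le_cbNorm_invFourier [CompleteSpace E] [Nontrivial E] [CompactSpace G] [BorelSpace G]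
    (μ : Measure G) [IsProbabilityMeasure μ] :
    1 ≤ cbNorm (l1HatNorm G J) (lInfNorm μ J) (invFourier J μ) := by
  classical
  obtain ⟨e, he⟩ := exists_norm_eq E zero_le_one
  have he' : ‖e‖ₑ = 1 := by rw [← ofReal_norm, he, ENNReal.ofReal_one]
  let i : Fin (trivialClass G).deg := ⟨0, (trivialClass G).rep.dim_pos⟩
  -- A unit vector placed at the trivial class has size at most 1, and its inverse transform is the
  -- constant `e`.
  let A : L1Hat G J := hatSingle J (trivialClass G) (Matrix.single i i e)
  have hA : l1Size J (A : MSpace G E) ≤ 1 := by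
    rw [l1Size_hatSingle]
    refine (mul_le_of_le_one_left' (by rw [trivialClass_deg, Nat.cast_one])).trans ?_
    exact (sOneNormE_vec_single_le J _ _ _).trans he'.le
  have hsum : ∀ g : G, ∑' π, invTerm (A : MSpace G E) g π = e := fun g => by
    rw [tsum_eq_single (trivialClass G), invTerm_eq, coe_hatSingle, Pi.single_eq_same,
      trivialClass_mat, traceMul_one_single, trivialClass_deg, Nat.cast_one, one_smul]
    intro π hπ
    rw [invTerm_eq, coe_hatSingle, Pi.single_eq_of_ne hπ, map_zero, smul_zero]
  have h1 : ‖invFourier J μ A‖ₑ = 1 := by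
    rw [Lp.enorm_def, eLpNorm_congr_ae (invFourier_ae_eq J μ A)]
    simp only [hsum]
    rw [eLpNorm_exponent_top, eLpNormEssSup_const _ (NeZero.ne μ), he']
  calc 1 = ‖invFourier J μ A‖ₑ := h1.symm
    _ ≤ _ := (isCbExtension_invFourier J μ).enorm_le A
    _ ≤ _ := mul_le_of_le_one_right' hA

end FourierCotype
end

theorem mainTheorem8
    {G : Type*} [Group G] [TopologicalSpace G] [IsTopologicalGroup G] [CompactSpace G] [T2Space G]
    [MeasurableSpace G] [BorelSpace G]
    (μ : MeasureTheory.Measure G) [μ.IsHaarMeasure] [μ.Regular]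
    [MeasureTheory.IsProbabilityMeasure μ]
    {H : Type*} [NormedAddCommGroup H] [InnerProductSpace ℂ H] [CompleteSpace H]
    {E : Type*} [NormedAddCommGroup E] [NormedSpace ℂ E] [CompleteSpace E] [Nontrivial E]
    (J : E →ₗᵢ[ℂ] (H →L[ℂ] H)) :
    FourierCotype.HasFourierCotypeInfty μ J ∧
    (∀ Λ Λ' : FourierCotype.L1Hat G J →ₗ[ℂ] MeasureTheory.Lp E ∞ μ,
      FourierCotype.IsCbExtension μ J Λ → FourierCotype.IsCbExtension μ J Λ' → Λ = Λ') ∧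
    ∀ Λ : FourierCotype.L1Hat G J →ₗ[ℂ] MeasureTheory.Lp E ∞ μ,
      FourierCotype.IsCbExtension μ J Λ →
        FourierCotype.cbNorm (FourierCotype.l1HatNorm G J) (FourierCotype.lInfNorm μ J) Λ = 1 ∧
        ∀ A : FourierCotype.L1Hat G J,
          (∀ g : G, Summable (FourierCotype.invTerm (A : FourierCotype.MSpace G E) g)) ∧
          ⇑(Λ A) =ᵐ[μ] fun g => ∑' π, FourierCotype.invTerm (A : FourierCotype.MSpace G E) g π := by
  have h := FourierCotype.isCbExtension_invFourier J μ
  refine ⟨⟨_, h⟩, fun Λ Λ' hΛ hΛ' => hΛ.unique hΛ', fun Λ hΛ => ?_⟩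
  -- By uniqueness, an arbitrary extension is the explicit series.
  obtain rfl := hΛ.unique h
  exact ⟨le_antisymm (FourierCotype.cbNorm_invFourier_le J μ)
    (FourierCotype.one_le_cbNorm_invFourier μ), fun A => ⟨FourierCotype.summable_invTerm J A,
    FourierCotype.invFourier_ae_eq J μ A⟩⟩
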